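/- Let $n_1\ge n_2\ge n_3\ge 0$ be integers and $q=n_1$. In the linear-shift deterministic Y-channel $\mathrm{DYC}(n_1,n_2,n_3)$, three users communicate through a relay. For each ordered pair of distinct users $j,k\in\{1,2,3\}$ there is a message $m_{jk}$ from user $j$ to user $k$; for block length $N$ and rates $R_{jk}\ge 0$ it is uniformly distributed on the integers $1\le m\le 2^{NR_{jk}}$, and the six messages are independent. In time slot $i=1,\dots,N$ user $j$ sends $x_{ji}\in\mathbb F_2^q$, a function of its two outgoing messages and of its past observations $y_{j1},\dots,y_{j,i-1}$, and the relay sends $x_{ri}\in\mathbb F_2^q$, a function of its past observations $y_{r1},\dots,y_{r,i-1}$. With the $q\times q$ downward shift matrix $S$ over $\mathbb F_2$, the received vectors are $$y_{ri}=\sum_{j=1}^3 S^{q-n_j}x_{ji},\qquad y_{ji}=S^{q-n_j}x_{ri}.$$ After slot $N$ user $j$ estimates the two messages intended for it from $y_{j1},\dots,y_{jN}$ and its own two outgoing messages; an error occurs if some user's estimate is wrong. A rate tuple $(R_{12},R_{13},R_{21},R_{23},R_{31},R_{32})\in\mathbb R_{\ge0}^6$ is achievable if there is a sequence of codes, one for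 each $N$, whose average error probability tends to $0$ as $N\to\infty$. The capacity region $\mathcal C_d$ is the set of achievable rate tuples. Every achievable rate tuple satisfies $$R_{kj}+R_{lj}+R_{kl}\le\max\{n_j,n_l\}\quad\text{and}\quad R_{kj}+R_{lj}+R_{kl}\le\max\{n_k,n_l\}$$ for all distinct $j,k,l\in\{1,2,3\}$, and $\mathcal C_d\subseteq\overline{\mathcal C}_d$, where $\overline{\mathcal C}_d$ is the set of all tuples in $\mathbb R_{\ge0}^6$ with $$\begin{aligned} R_{31}+R_{32}&\le n_3, & R_{13}+R_{23}&\le n_3,\\ R_{12}+R_{32}+R_{13}&\le n_2, & R_{12}+R_{32}+R_{31}&\le n_1,\\ R_{21}+R_{31}+R_{32}&\le n_2, & R_{21}+R_{31}+R_{23}&\le n_2,\\ R_{13}+R_{23}+R_{12}&\le n_2, & R_{13}+R_{23}+R_{21}&\le n_1. \end{aligned}$$ Moreover, this bound is at least as tight as the cut-set bound, and strictly tighter if $n_3>0$: $\overline{\mathcal C}_d$ is contained in the set of all tuples in $\mathbb R_{\ge0}^6$ with $R_{jk}+R_{jl}\le\min\{n_j,\max\{n_k,n_l\}\}$ and $R_{kj}+R_{lj}\le\min\{n_j,\max\{n_k,n_l\}\}$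 for all distinct $j,k,l\in\{1,2,3\}$, and differs from it if $n_3>0$. -/

import Mathlib

/-! The linear-shift deterministic Y-channel DYC(n₁, n₂, n₃).
Users `1, 2, 3` of the text are the elements `0, 1, 2` of `Fin 3`; `n j` is the number of levels
of user `j`. -/

namespace DYC

/-- A message stream: an ordered pair (source, destination) of distinct users. -/
abbrev Link : Type := {p : Fin 3 × Fin 3 // p.1 ≠ p.2}

/-- The stream from user `j` to user `k`. -/
abbrev link (j k : Fin 3) (h : j ≠ k := by decide) : Link := ⟨(j, k), h⟩

/-- Six-dimensional rate tuples; `R (link j k)` is the rate of the stream from `j` to `k`. -/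
abbrev RateTuple : Type := Link → ℝ

/-- The length `q = max_j n_j` of all transmitted and received binary vectors. -/
def q (n : Fin 3 → ℕ) : ℕ := Finset.univ.sup n

/-- Binary vectors of length `q`; component `0` is the most significant one. -/
abbrev Vec (n : Fin 3 → ℕ) : Type := Fin (q n) → ZMod 2

/-- The `q × q` downward shift matrix over the binary field. -/
def shift (n : Fin 3 → ℕ) : Matrix (Fin (q n)) (Fin (q n)) (ZMod 2) :=
  Matrix.of fun a b => if (a : ℕ) = (b : ℕ) + 1 then 1 else 0

/-- The channel between user `j` and the relay, used in both directions: a down-shift that keeps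
the `n j` most significant bits. -/
def clip (n : Fin 3 → ℕ) (j : Fin 3) (x : Vec n) : Vec n :=
  Matrix.mulVec (shift n ^ (q n - n j)) x

/-- The message set of a stream for block length `N`: it has `⌊2 ^ (N * R p)⌋` elements, as has
the set of all integers `m` with `1 ≤ m ≤ 2 ^ (N * R p)`. -/
abbrev Msg (R : RateTuple) (N : ℕ) (p : Link) : Type := Fin ⌊(2 : ℝ) ^ ((N : ℝ) * R p)⌋₊

/-- Tuples of all six messages. -/
abbrev Messages (R : RateTuple) (N : ℕ) : Type := (p : Link) → Msg R N p

/-- The two outgoing messages of user `j`. -/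
abbrev Outgoing (R : RateTuple) (N : ℕ) (j : Fin 3) : Type :=
  (p : {p : Link // p.1.1 = j}) → Msg R N p.1

/-- The two messages intended for user `j`. -/
abbrev Incoming (R : RateTuple) (N : ℕ) (j : Fin 3) : Type :=
  (p : {p : Link // p.1.2 = j}) → Msg R N p.1

/-- The outgoing messages of user `j` in a message tuple. -/
def Messages.outgoing {R : RateTuple} {N : ℕ} (m : Messages R N) (j : Fin 3) : Outgoing R N j :=
  fun p => m p.1

/-- The messages intended for user `j` in a message tuple. -/
def Messages.incoming {R : RateTuple} {N : ℕ} (m : Messages R N) (j : Fin 3) : Incoming R N j :=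
  fun p => m p.1

/-- The signals received in one time slot, by the relay and by the three users. -/
structure Received (n : Fin 3 → ℕ) where
  relay : Vec n
  user : Fin 3 → Vec n

/-- A code of block length `N` and rate tuple `R`. Time slots are numbered from `0`, so that `i`
symbols have been received before slot `i`. -/
structure Code (n : Fin 3 → ℕ) (R : RateTuple) (N : ℕ) where
  /-- encoding functions of the users -/
  enc : (j : Fin 3) → (i : Fin N) → Outgoing R N j → (Fin i → Vec n) → Vec n
  /-- encoding functions of the relay -/
  relayEnc : (i : Fin N) → (Fin i → Vec n) → Vec n
  /-- decoding functions of the users -/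
  dec : (j : Fin 3) → (Fin N → Vec n) → Outgoing R N j → Incoming R N j

namespace Code

variable {n : Fin 3 → ℕ} {R : RateTuple} {N : ℕ}

/-- What is received in slot `i` when the messages are `m` and `past` was received before. -/
def step (C : Code n R N) (m : Messages R N) (i : Fin N) (past : Fin i → Received n) :
    Received n where
  relay := ∑ j : Fin 3, clip n j (C.enc j i (Messages.outgoing m j) fun t => (past t).user j)
  user := fun j => clip n j (C.relayEnc i fun t => (past t).relay)

/-- Everything received in the first `i` slots when the messages are `m`. -/
def history (C : Code n R N) (m : Messages R N) : (i : ℕ) → i ≤ N → (Fin i → Received n)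
  | 0, _ => Fin.elim0
  | i + 1, h =>
    Fin.snoc (α := fun _ => Received n) (C.history m i (Nat.le_of_succ_le h))
      (C.step m ⟨i, h⟩ (C.history m i (Nat.le_of_succ_le h)))

/-- The block of `N` vectors received by user `j`. -/
def output (C : Code n R N) (m : Messages R N) (j : Fin 3) : Fin N → Vec n :=
  fun t => (C.history m N le_rfl t).user j

/-- The messages `m` lead to an error: some user does not recover its two messages. -/
def Error (C : Code n R N) (m : Messages R N) : Prop :=
  ∃ j : Fin 3, C.dec j (C.output m j) (Messages.outgoing m j) ≠ Messages.incoming m j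

/-- The average error probability: the six messages are independent and uniform, that is, the
message tuple is uniform on the finite product of the message sets. -/
noncomputable def errorProb (C : Code n R N) : ℝ :=
  (Nat.card {m : Messages R N // C.Error m} : ℝ) / (Nat.card (Messages R N) : ℝ)

end Code

/-- A tuple of nonnegative rates is achievable if there is a sequence of codes, one for each block
length, whose average error probability tends to zero. -/
def Achievable (n : Fin 3 → ℕ) (R : RateTuple) : Prop :=
  (∀ p, 0 ≤ R p) ∧
    ∃ C : (N : ℕ) → Code n R N, Filter.Tendsto (fun N => (C N).errorProb) Filter.atTop (nhds 0)

/-- The capacity region. -/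
def capacityRegion (n : Fin 3 → ℕ) : Set RateTuple := {R | Achievable n R}

/-- The outer bound: the genie-aided bounds and the remaining cut-set bounds. -/
def outerRegion (n : Fin 3 → ℕ) : Set RateTuple :=
  {R | (∀ p, 0 ≤ R p) ∧
    R (link 2 0) + R (link 2 1) ≤ n 2 ∧
    R (link 0 2) + R (link 1 2) ≤ n 2 ∧
    R (link 0 1) + R (link 2 1) + R (link 0 2) ≤ n 1 ∧
    R (link 0 1) + R (link 2 1) + R (link 2 0) ≤ n 0 ∧
    R (link 1 0) + R (link 2 0) + R (link 2 1) ≤ n 1 ∧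
    R (link 1 0) + R (link 2 0) + R (link 1 2) ≤ n 1 ∧
    R (link 0 2) + R (link 1 2) + R (link 0 1) ≤ n 1 ∧
    R (link 0 2) + R (link 1 2) + R (link 1 0) ≤ n 0}

/-- The region in the nonnegative orthant given by the cut-set bounds. -/
def cutSetRegion (n : Fin 3 → ℕ) : Set RateTuple :=
  {R | (∀ p, 0 ≤ R p) ∧
    ∀ (j k l : Fin 3) (hjk : j ≠ k) (hjl : j ≠ l), k ≠ l →
      R (link j k hjk) + R (link j l hjl) ≤ ((min (n j) (max (n k) (n l)) : ℕ) : ℝ) ∧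
      R (link k j hjk.symm) + R (link l j hjl.symm) ≤ ((min (n j) (max (n k) (n l)) : ℕ) : ℝ)}

end DYC

/-! Every bound on the capacity region is a counting bound. Suppose that, for each code, some signal
`f m` of `N` vectors in the range of `clip n u` determines the messages on a set `A` of streams
once the messages off `A` are known, among the error-free message tuples. The range of `clip n u`
has at most `2 ^ n u` elements, so the fraction of error-free tuples is at most
`2 ^ (N * n u) / ∏ p ∈ A, |Msg R N p|`, which tends to `0` if `n u < ∑ p ∈ A, R p`. This is
`sum_rate_le`; it needs no entropy or Fano inequality.

There are two kinds of signal `f`. On the downlink it is the block received by user `u`; the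
block of a user with fewer levels is a function of it (`clip_eq_of_le`). On the uplink it is
`Code.residual`: what the relay receives less the contributions of a set `U` of users whose
messages are all known. Slot by slot, this and the past determine the next relay input, hence the
next outputs and the next transmissions of `U`, so it determines all outputs
(`Code.signal_eq_of_residual_eq`).

For the genie-aided bounds on `A = {k → j, l → j, k → l}`, user `j` first decodes its own messages;
`l → j` is then known, and with it and the genie's `l → k` the output of user `l` yields `k → l`.
-/

namespace DYC

open Filter Finset

/-! ### The shift channel -/

section Shift

variable {n : Fin 3 → ℕ}

theorem shift_pow_apply (d : ℕ) (a b : Fin (q n)) :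
    (shift n ^ d) a b = if (a : ℕ) = b + d then 1 else 0 := by
  induction d generalizing a with
  | zero => simp [Matrix.one_apply, Fin.ext_iff]
  | succ d ih =>
    rw [pow_succ', Matrix.mul_apply]
    simp only [ih, mul_ite, mul_one, mul_zero]
    by_cases h : (b : ℕ) + d < q n
    · rw [Finset.sum_eq_single ⟨b + d, h⟩]
      · simp [shift, add_assoc]
      · intro c _ hc
        rw [if_neg fun h' => hc (Fin.ext h')]
      · simp
    · rw [if_neg (by have := a.2; omega)]
      exact Finset.sum_eq_zero fun c _ => if_neg (by have := c.2; omega)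

theorem le_q (j : Fin 3) : n j ≤ q n := Finset.le_sup (Finset.mem_univ j)

/-- Only the `n j` leading bits of the input reach the output. -/
theorem clip_congr (j : Fin 3) {x y : Vec n} (h : ∀ b : Fin (q n), (b : ℕ) < n j → x b = y b) :
    clip n j x = clip n j y := by
  ext a
  simp only [clip, Matrix.mulVec, dotProduct, shift_pow_apply]
  refine Finset.sum_congr rfl fun b _ => ?_
  split_ifs with hab
  · rw [h b (by have := le_q (n := n) j; omega)]
  · simp

theorem card_range_clip_le (j : Fin 3) : Nat.card (Set.range (clip n j)) ≤ 2 ^ n j := by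
  let e : (Fin (n j) → ZMod 2) → Set.range (clip n j) := fun z =>
    ⟨clip n j fun b => if h : (b : ℕ) < n j then z ⟨b, h⟩ else 0, Set.mem_range_self _⟩
  have he : Function.Surjective e := by
    rintro ⟨_, x, rfl⟩
    refine ⟨fun b => x (b.castLE (le_q j)), Subtype.ext (clip_congr j fun b hb => ?_)⟩
    simp [hb]
  simpa using Nat.card_le_card_of_surjective e he

theorem clip_eq_of_le {j l : Fin 3} (h : n j ≤ n l) (x : Vec n) :
    clip n j x = Matrix.mulVec (shift n ^ (n l - n j)) (clip n l x) := by
  have hl := le_q (n := n) l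
  rw [clip, clip, Matrix.mulVec_mulVec, ← pow_add,
    show n l - n j + (q n - n l) = q n - n j by omega]

theorem range_clip_subset {j l : Fin 3} (h : n j ≤ n l) :
    Set.range (clip n j) ⊆ Set.range (clip n l) := by
  rintro _ ⟨x, rfl⟩
  refine ⟨Matrix.mulVec (shift n ^ (n l - n j)) x, ?_⟩
  rw [clip_eq_of_le h, clip, clip, Matrix.mulVec_mulVec, Matrix.mulVec_mulVec,
    (Commute.refl (shift n)).pow_pow]

theorem sum_mem_range_clip {u : Fin 3} {s : Finset (Fin 3)} (hs : ∀ j ∈ s, n j ≤ n u)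
    (x : Fin 3 → Vec n) : ∑ j ∈ s, clip n j (x j) ∈ Set.range (clip n u) := by
  have h : ∀ j ∈ s, clip n j (x j) ∈ LinearMap.range (Matrix.mulVecLin (shift n ^ (q n - n u))) :=
    fun j hj => range_clip_subset (hs j hj) ⟨x j, rfl⟩
  exact Submodule.sum_mem _ h

end Shift

/-! ### Signals produced by a code -/

namespace Code

variable {n : Fin 3 → ℕ} {R : RateTuple} {N : ℕ}

/-- The signals received in slot `t` when the messages are `m`. -/
def signal (C : Code n R N) (m : Messages R N) (t : Fin N) : Received n :=
  C.step m t (C.history m t t.2.le)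

theorem history_apply (C : Code n R N) (m : Messages R N) (i : ℕ) (h : i ≤ N) (t : Fin i) :
    C.history m i h t = C.signal m (t.castLE h) := by
  induction i with
  | zero => exact t.elim0
  | succ i ih =>
    rw [history]
    refine Fin.lastCases ?_ (fun s => ?_) t
    · rw [Fin.snoc_last]
      rfl
    · rw [Fin.snoc_castSucc, ih]
      rfl

/-- The received signals obey the recursion of the channel with the past written as earlier
values of `signal`. -/
theorem signal_eq (C : Code n R N) (m : Messages R N) (t : Fin N) :
    C.signal m t = C.step m t fun s => C.signal m (s.castLE t.2.le) := by
  rw [signal]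
  congr 1
  funext s
  exact C.history_apply m t t.2.le s

theorem output_apply (C : Code n R N) (m : Messages R N) (j : Fin 3) (t : Fin N) :
    C.output m j t = (C.signal m t).user j := by
  rw [output, history_apply]
  rfl

theorem output_mem_range_clip (C : Code n R N) (m : Messages R N) (j : Fin 3) (t : Fin N) :
    C.output m j t ∈ Set.range (clip n j) := by
  rw [output_apply]
  exact Set.mem_range_self _

theorem output_eq_of_le (C : Code n R N) {m m' : Messages R N} {j l : Fin 3} (h : n j ≤ n l)
    (hl : C.output m l = C.output m' l) : C.output m j = C.output m' j := by
  have key : ∀ (m : Messages R N) t,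
      C.output m j t = Matrix.mulVec (shift n ^ (n l - n j)) (C.output m l t) := fun m t => by
    rw [output_apply, output_apply]
    exact clip_eq_of_le h _
  funext t
  rw [key, key, hl]

/-- The part of the relay's input in slot `t` that comes from the users outside `U`. -/
def residual (C : Code n R N) (U : Finset (Fin 3)) (m : Messages R N) (t : Fin N) : Vec n :=
  ∑ j ∈ Uᶜ, clip n j
    (C.enc j t (Messages.outgoing m j) fun s => (C.signal m (s.castLE t.2.le)).user j)

/-- The messages of the users in `U` and the residual signal of the others determine everything
that is received: by induction on the slot, the users in `U` send the same, so the relay receives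
the same. -/
theorem signal_eq_of_residual_eq (C : Code n R N) {U : Finset (Fin 3)} {m m' : Messages R N}
    (hU : ∀ p : Link, p.1.1 ∈ U → m p = m' p) (h : C.residual U m = C.residual U m') (t : Fin N) :
    C.signal m t = C.signal m' t := by
  obtain ⟨t, ht⟩ := t
  induction t using Nat.strong_induction_on with
  | _ t ih =>
    have hpast : (fun s : Fin t => C.signal m (s.castLE ht.le)) =
        fun s : Fin t => C.signal m' (s.castLE ht.le) := funext fun s => ih s s.2 _
    have hout : ∀ j ∈ U, Messages.outgoing m j = Messages.outgoing m' j := fun j hj =>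
      funext fun p => hU p.1 (by rwa [p.2])
    rw [signal_eq, signal_eq]
    simp only [step, Received.mk.injEq]
    constructor
    · rw [← Finset.sum_add_sum_compl U, ← Finset.sum_add_sum_compl U]
      refine congr_arg₂ (· + ·) (Finset.sum_congr rfl fun j hj => ?_) (congr_fun h ⟨t, ht⟩)
      rw [hout j hj, show (fun s : Fin t => (C.signal m (s.castLE ht.le)).user j) =
        fun s : Fin t => (C.signal m' (s.castLE ht.le)).user j from
          funext fun s => congr_arg (·.user j) (congr_fun hpast s)]
    · rw [show (fun s : Fin t => (C.signal m (s.castLE ht.le)).relay) =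
        fun s : Fin t => (C.signal m' (s.castLE ht.le)).relay from
          funext fun s => congr_arg (·.relay) (congr_fun hpast s)]

theorem output_eq_of_residual_eq (C : Code n R N) {U : Finset (Fin 3)} {m m' : Messages R N}
    (hU : ∀ p : Link, p.1.1 ∈ U → m p = m' p) (h : C.residual U m = C.residual U m')
    (j : Fin 3) : C.output m j = C.output m' j := by
  funext t
  rw [output_apply, output_apply, C.signal_eq_of_residual_eq hU h]

/-- A user with the same observations and the same outgoing messages decodes the same. -/
theorem incoming_eq (C : Code n R N) {m m' : Messages R N} (hm : ¬C.Error m) (hm' : ¬C.Error m')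
    {j : Fin 3} (hy : C.output m j = C.output m' j) (hout : ∀ p : Link, p.1.1 = j → m p = m' p)
    {p : Link} (hp : p.1.2 = j) : m p = m' p := by
  simp only [Error, not_exists, not_not] at hm hm'
  have h : Messages.incoming m j = Messages.incoming m' j := by
    rw [← hm, ← hm', hy, show Messages.outgoing m j = Messages.outgoing m' j from
      funext fun p => hout p.1 p.2]
  exact congr_fun h ⟨p, hp⟩

/-- The genie-aided decoding: user `j` decodes its messages, and these together with the message
from `l` to `k` are what user `l` needs. -/
theorem eq_of_genie (C : Code n R N) {m m' : Messages R N} (hm : ¬C.Error m) (hm' : ¬C.Error m')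
    {j k l : Fin 3} (hkj : k ≠ j) (hlj : l ≠ j) (hkl : k ≠ l)
    (hA : ∀ p ∉ ({link k j hkj, link l j hlj, link k l hkl} : Finset Link), m p = m' p)
    (hj : C.output m j = C.output m' j) (hl : C.output m l = C.output m' l) : m = m' := by
  have h1 : ∀ p : Link, p.1.2 = j → m p = m' p := fun p hp => by
    refine C.incoming_eq hm hm' hj (fun p hp => hA p ?_) hp
    simp only [mem_insert, mem_singleton, Subtype.ext_iff, Prod.ext_iff]
    grind
  have h2 : ∀ p : Link, p.1.2 = l → m p = m' p := fun p hp => by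
    refine C.incoming_eq hm hm' hl (fun p hp => ?_) hp
    by_cases hpj : p.1.2 = j
    · exact h1 p hpj
    · refine hA p ?_
      simp only [mem_insert, mem_singleton, Subtype.ext_iff, Prod.ext_iff]
      grind
  funext p
  by_cases hp : p.1.2 = j
  · exact h1 p hp
  by_cases hp' : p.1.2 = l
  · exact h2 p hp'
  refine hA p ?_
  simp only [mem_insert, mem_singleton, Subtype.ext_iff, Prod.ext_iff]
  grind

/-! ### Counting error-free message tuples -/

theorem card_not_error_mul_prod_le (C : Code n R N) (A : Finset Link) (u : Fin 3)
    (f : Messages R N → Fin N → Vec n) (hf : ∀ m t, f m t ∈ Set.range (clip n u))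
    (hinj : ∀ m m', ¬C.Error m → ¬C.Error m' → (∀ p ∉ A, m p = m' p) → f m = f m' → m = m') :
    Nat.card {m // ¬C.Error m} * ∏ p ∈ A, ⌊(2 : ℝ) ^ ((N : ℝ) * R p)⌋₊
      ≤ 2 ^ (n u * N) * Nat.card (Messages R N) := by
  let g : {m // ¬C.Error m} →
      ((p : {p // p ∉ A}) → Msg R N p.1) × (Fin N → Set.range (clip n u)) :=
    fun m => (fun p => m.1 p.1, fun t => ⟨f m.1 t, hf m.1 t⟩)
  have hg : Function.Injective g := by
    intro m m' h
    obtain ⟨h1, h2⟩ := Prod.mk.inj h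
    exact Subtype.ext (hinj _ _ m.2 m'.2 (fun p hp => congr_fun h1 ⟨p, hp⟩)
      (funext fun t => congr_arg Subtype.val (congr_fun h2 t)))
  have hcard := Nat.card_le_card_of_injective g hg
  rw [Nat.card_prod, Nat.card_pi, Nat.card_pi, Finset.prod_const, Finset.card_univ,
    Fintype.card_fin] at hcard
  simp only [Nat.card_fin] at hcard
  have hrange : Nat.card (Set.range (clip n u)) ^ N ≤ 2 ^ (n u * N) := by
    rw [pow_mul]
    exact Nat.pow_le_pow_left (card_range_clip_le u) N
  have hM : Nat.card (Messages R N) = (∏ p : {p // p ∉ A}, ⌊(2 : ℝ) ^ ((N : ℝ) * R p.1)⌋₊) *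
      ∏ p ∈ A, ⌊(2 : ℝ) ^ ((N : ℝ) * R p)⌋₊ := by
    rw [Nat.card_pi, ← Finset.prod_compl_mul_prod A]
    simp only [Nat.card_fin]
    congr 1
    exact Finset.prod_subtype _ (by simp) _
  rw [hM, mul_comm (2 ^ _), mul_right_comm]
  refine Nat.mul_le_mul_right _ (hcard.trans ?_)
  exact Nat.mul_le_mul_left _ hrange

theorem one_sub_errorProb (C : Code n R N) (hR : ∀ p, 0 ≤ R p) :
    1 - C.errorProb = (Nat.card {m // ¬C.Error m} : ℝ) / Nat.card (Messages R N) := by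
  classical
  have : ∀ p, Nonempty (Msg R N p) := fun p => ⟨⟨0, Nat.floor_pos.2
    (Real.one_le_rpow one_le_two (mul_nonneg N.cast_nonneg (hR p)))⟩⟩
  have hpos : (0 : ℝ) < Nat.card (Messages R N) := Nat.cast_pos.2 Nat.card_pos
  have hsum : (Nat.card {m // C.Error m} : ℝ) + Nat.card {m // ¬C.Error m}
      = Nat.card (Messages R N) := by
    rw [← Nat.cast_add, ← Nat.card_sum]
    exact congr_arg _ (Nat.card_congr (Equiv.sumCompl C.Error))
  rw [errorProb, eq_div_iff hpos.ne', sub_mul, div_mul_cancel₀ _ hpos.ne', one_mul, ← hsum,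
    add_sub_cancel_left]

theorem one_sub_errorProb_le (C : Code n R N) (hR : ∀ p, 0 ≤ R p) (A : Finset Link) (u : Fin 3)
    (f : Messages R N → Fin N → Vec n) (hf : ∀ m t, f m t ∈ Set.range (clip n u))
    (hinj : ∀ m m', ¬C.Error m → ¬C.Error m' → (∀ p ∉ A, m p = m' p) → f m = f m' → m = m') :
    1 - C.errorProb ≤ 2 ^ #A * ((2 : ℝ) ^ ((n u : ℝ) - ∑ p ∈ A, R p)) ^ N := by
  have hcount : (Nat.card {m // ¬C.Error m} : ℝ) * ∏ p ∈ A, (⌊(2 : ℝ) ^ ((N : ℝ) * R p)⌋₊ : ℝ)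
      ≤ 2 ^ (n u * N) * Nat.card (Messages R N) := by
    exact_mod_cast C.card_not_error_mul_prod_le A u f hf hinj
  -- Taking the integer part of a real `≥ 1` loses at most a factor `2`.
  have hfloor : (2 : ℝ) ^ ((N : ℝ) * ∑ p ∈ A, R p)
      ≤ 2 ^ #A * ∏ p ∈ A, (⌊(2 : ℝ) ^ ((N : ℝ) * R p)⌋₊ : ℝ) := by
    rw [Finset.mul_sum, Real.rpow_sum_of_pos two_pos, ← Finset.prod_const,
      ← Finset.prod_mul_distrib]
    refine Finset.prod_le_prod (fun p _ => by positivity) fun p _ => ?_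
    have h1 : 1 ≤ ⌊(2 : ℝ) ^ ((N : ℝ) * R p)⌋₊ := Nat.floor_pos.2
      (Real.one_le_rpow one_le_two (mul_nonneg N.cast_nonneg (hR p)))
    have h2 := Nat.lt_floor_add_one ((2 : ℝ) ^ ((N : ℝ) * R p))
    have h3 : (1 : ℝ) ≤ ⌊(2 : ℝ) ^ ((N : ℝ) * R p)⌋₊ := by exact_mod_cast h1
    linarith
  have hpow : ((2 : ℝ) ^ ((n u : ℝ) - ∑ p ∈ A, R p)) ^ N * (2 : ℝ) ^ ((N : ℝ) * ∑ p ∈ A, R p)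
      = 2 ^ (n u * N) := by
    rw [← Real.rpow_natCast, ← Real.rpow_mul two_pos.le, ← Real.rpow_add two_pos,
      ← Real.rpow_natCast]
    congr 1
    push_cast
    ring
  rw [C.one_sub_errorProb hR]
  refine div_le_of_le_mul₀ (Nat.cast_nonneg _) (by positivity) ?_
  have hP : (0 : ℝ) < 2 ^ ((N : ℝ) * ∑ p ∈ A, R p) := by positivity
  refine le_of_mul_le_mul_right ?_ hP
  calc (Nat.card {m // ¬C.Error m} : ℝ) * 2 ^ ((N : ℝ) * ∑ p ∈ A, R p)
      ≤ Nat.card {m // ¬C.Error m} * (2 ^ #A * ∏ p ∈ A, (⌊(2 : ℝ) ^ ((N : ℝ) * R p)⌋₊ : ℝ)) := by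
        gcongr
    _ ≤ 2 ^ #A * (2 ^ (n u * N) * Nat.card (Messages R N)) := by
        rw [mul_left_comm]
        gcongr
    _ = _ := by
        rw [← hpow]
        ring

end Code

/-! ### Bounds on achievable rates -/

section Bounds

variable {n : Fin 3 → ℕ} {R : RateTuple}

/-- If a signal taking values in the range of `clip n u` resolves the streams in `A` given all
other messages, then the sum of the rates in `A` is at most `n u`. -/
theorem sum_rate_le (hR : R ∈ capacityRegion n) (A : Finset Link) (u : Fin 3)
    (h : ∀ N (C : Code n R N), ∃ f : Messages R N → Fin N → Vec n,
      (∀ m t, f m t ∈ Set.range (clip n u)) ∧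
      ∀ m m', ¬C.Error m → ¬C.Error m' → (∀ p ∉ A, m p = m' p) → f m = f m' → m = m') :
    ∑ p ∈ A, R p ≤ n u := by
  obtain ⟨hpos, C, hC⟩ := hR
  by_contra! hlt
  have hr : (2 : ℝ) ^ ((n u : ℝ) - ∑ p ∈ A, R p) < 1 :=
    Real.rpow_lt_one_of_one_lt_of_neg one_lt_two (sub_neg.2 hlt)
  have h0 : Tendsto (fun N => 2 ^ #A * ((2 : ℝ) ^ ((n u : ℝ) - ∑ p ∈ A, R p)) ^ N) atTop
      (nhds (2 ^ #A * 0)) :=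
    (tendsto_pow_atTop_nhds_zero_of_lt_one (by positivity) hr).const_mul _
  have h1 : Tendsto (fun N => 1 - (C N).errorProb) atTop (nhds (1 - 0)) := hC.const_sub 1
  have hle := le_of_tendsto_of_tendsto' h1 h0 fun N => by
    obtain ⟨f, hf, hinj⟩ := h N (C N)
    exact (C N).one_sub_errorProb_le hpos A u f hf hinj
  norm_num at hle

theorem sum_genie {j k l : Fin 3} (hkj : k ≠ j) (hlj : l ≠ j) (hkl : k ≠ l) :
    ∑ p ∈ ({link k j hkj, link l j hlj, link k l hkl} : Finset Link), R p
      = R (link k j hkj) + R (link l j hlj) + R (link k l hkl) := by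
  rw [Finset.sum_insert, Finset.sum_pair, add_assoc]
  · simp [Subtype.ext_iff, hkl.symm]
  · simp [Subtype.ext_iff, hkl, hlj.symm]

theorem genie_downlink (hR : R ∈ capacityRegion n) {j k l : Fin 3} (hkj : k ≠ j) (hlj : l ≠ j)
    (hkl : k ≠ l) :
    R (link k j hkj) + R (link l j hlj) + R (link k l hkl) ≤ ((max (n j) (n l) : ℕ) : ℝ) := by
  rw [← sum_genie hkj hlj hkl]
  rcases le_total (n j) (n l) with h | h
  · rw [max_eq_right h]
    exact sum_rate_le hR _ l fun N C => ⟨fun m => C.output m l,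
      fun m t => C.output_mem_range_clip m l t, fun m m' hm hm' hA hf =>
        C.eq_of_genie hm hm' hkj hlj hkl hA (C.output_eq_of_le h hf) hf⟩
  · rw [max_eq_left h]
    exact sum_rate_le hR _ j fun N C => ⟨fun m => C.output m j,
      fun m t => C.output_mem_range_clip m j t, fun m m' hm hm' hA hf =>
        C.eq_of_genie hm hm' hkj hlj hkl hA hf (C.output_eq_of_le h hf)⟩

theorem genie_uplink (hR : R ∈ capacityRegion n) {j k l : Fin 3} (hkj : k ≠ j) (hlj : l ≠ j)
    (hkl : k ≠ l) :
    R (link k j hkj) + R (link l j hlj) + R (link k l hkl) ≤ ((max (n k) (n l) : ℕ) : ℝ) := by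
  rw [← sum_genie hkj hlj hkl]
  obtain ⟨u, hu, hku, hlu⟩ : ∃ u, max (n k) (n l) = n u ∧ n k ≤ n u ∧ n l ≤ n u := by
    rcases le_total (n k) (n l) with h | h
    · exact ⟨l, max_eq_right h, h, le_rfl⟩
    · exact ⟨k, max_eq_left h, le_rfl, h⟩
  rw [hu]
  refine sum_rate_le hR _ u fun N C => ⟨C.residual {j}, fun m t => sum_mem_range_clip ?_ _,
    fun m m' hm hm' hA hf => ?_⟩
  · intro i hi
    rw [mem_compl, mem_singleton] at hi
    rcases (show i = k ∨ i = l by omega) with rfl | rfl <;> assumption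
  · have hout := C.output_eq_of_residual_eq (fun p hp => hA p ?_) hf
    · exact C.eq_of_genie hm hm' hkj hlj hkl hA (hout j) (hout l)
    · rw [mem_singleton] at hp
      simp only [mem_insert, mem_singleton, Subtype.ext_iff, Prod.ext_iff]
      grind

/-- The cut-set bound for the transmissions of user `j`. -/
theorem outgoing_rate_le (hR : R ∈ capacityRegion n) {j k l : Fin 3} (hjk : j ≠ k) (hjl : j ≠ l)
    (hkl : k ≠ l) : R (link j k hjk) + R (link j l hjl) ≤ n j := by
  rw [← Finset.sum_pair (by simp [Subtype.ext_iff, hkl])]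
  refine sum_rate_le hR _ j fun N C => ⟨C.residual {k, l}, fun m t => sum_mem_range_clip ?_ _,
    fun m m' hm hm' hA hf => ?_⟩
  · intro i hi
    rw [mem_compl, mem_insert, mem_singleton] at hi
    rw [show i = j by omega]
  · have hoff : ∀ p : Link, p.1.1 ≠ j → m p = m' p := fun p hp => hA p (by
      simp only [mem_insert, mem_singleton, Subtype.ext_iff, Prod.ext_iff]
      grind)
    have hout := C.output_eq_of_residual_eq (fun p hp => hoff p ?_) hf
    · funext p
      by_cases hp : p.1.1 = j
      · exact C.incoming_eq hm hm' (hout p.1.2) (fun p' hp' => hoff p'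
          (by rw [hp']; exact fun h => p.2 (hp.trans h.symm))) rfl
      · exact hoff p hp
    · rw [mem_insert, mem_singleton] at hp
      grind

/-- The cut-set bound for the observations of user `j`. -/
theorem incoming_rate_le (hR : R ∈ capacityRegion n) {j k l : Fin 3} (hkj : k ≠ j) (hlj : l ≠ j)
    (hkl : k ≠ l) : R (link k j hkj) + R (link l j hlj) ≤ n j := by
  rw [← Finset.sum_pair (by simp [Subtype.ext_iff, hkl])]
  refine sum_rate_le hR _ j fun N C => ⟨fun m => C.output m j,
    fun m t => C.output_mem_range_clip m j t, fun m m' hm hm' hA hf => ?_⟩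
  have hoff : ∀ p : Link, p.1.2 ≠ j → m p = m' p := fun p hp => hA p (by
    simp only [mem_insert, mem_singleton, Subtype.ext_iff, Prod.ext_iff]
    grind)
  funext p
  by_cases hp : p.1.2 = j
  · exact C.incoming_eq hm hm' hf (fun p' hp' => hoff p'
      fun h => p'.2 (hp'.trans h.symm)) hp
  · exact hoff p hp

end Bounds

/-! ### Comparison of the regions -/

section Regions

variable {n : Fin 3 → ℕ}

theorem capacityRegion_subset_outerRegion (h12 : n 1 ≤ n 0) (h23 : n 2 ≤ n 1) :
    capacityRegion n ⊆ outerRegion n := by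
  intro R hR
  have h13 := h23.trans h12
  have d := fun j k l hkj hlj hkl => genie_downlink (j := j) (k := k) (l := l) hR hkj hlj hkl
  have u := fun j k l hkj hlj hkl => genie_uplink (j := j) (k := k) (l := l) hR hkj hlj hkl
  have b1 := d 1 0 2 (by decide) (by decide) (by decide)
  have b2 := d 1 2 0 (by decide) (by decide) (by decide)
  have b3 := u 0 2 1 (by decide) (by decide) (by decide)
  have b4 := u 0 1 2 (by decide) (by decide) (by decide)
  have b5 := d 2 0 1 (by decide) (by decide) (by decide)
  have b6 := u 2 1 0 (by decide) (by decide) (by decide)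
  simp only [max_eq_right h12, max_eq_left h23, max_eq_right h23]
    at b1 b2 b3 b4 b5 b6
  exact ⟨hR.1, outgoing_rate_le hR (by decide) (by decide) (by decide),
    incoming_rate_le hR (by decide) (by decide) (by decide),
    b1, by linarith, by linarith, b4, b5, by linarith⟩

theorem outerRegion_subset_cutSetRegion (h12 : n 1 ≤ n 0) (h23 : n 2 ≤ n 1) :
    outerRegion n ⊆ cutSetRegion n := by
  rintro R ⟨hpos, h1, h2, h3, -, h5, h6, h7, -⟩
  have h13 := h23.trans h12
  refine ⟨hpos, fun j k l hjk hjl hkl => ?_⟩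
  have p01 := hpos (link 0 1)
  have p02 := hpos (link 0 2)
  have p10 := hpos (link 1 0)
  have p12 := hpos (link 1 2)
  have p20 := hpos (link 2 0)
  have p21 := hpos (link 2 1)
  fin_cases j <;> fin_cases k <;> first | exact absurd rfl hjk | skip
  all_goals fin_cases l <;> first | exact absurd rfl hjl | exact absurd rfl hkl | skip
  all_goals
    simp [max_eq_left h12, max_eq_left h13, max_eq_left h23, max_eq_right h12,
      max_eq_right h13, max_eq_right h23, min_eq_right h12, min_eq_left h12, min_eq_left h13,
      -Nat.cast_min, -Nat.cast_max]
    constructor <;> linarith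

/-- The tuple with `R₁₂ = n₂`, `R₂₃ = n₃` and all other rates zero meets the cut-set bounds and
violates `R₁₃ + R₂₃ + R₁₂ ≤ n₂`. -/
theorem outerRegion_ne_cutSetRegion (h12 : n 1 ≤ n 0) (h23 : n 2 ≤ n 1) (h : 0 < n 2) :
    outerRegion n ≠ cutSetRegion n := by
  have h13 := h23.trans h12
  let R : RateTuple := fun p => if p.1 = (0, 1) then n 1 else if p.1 = (1, 2) then n 2 else 0
  have hR : R ∈ cutSetRegion n := by
    have hc : (n 2 : ℝ) ≤ n 1 := by exact_mod_cast h23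
    refine ⟨fun p => by simp only [R]; split_ifs <;> positivity, fun j k l hjk hjl hkl => ?_⟩
    fin_cases j <;> fin_cases k <;> first | exact absurd rfl hjk | skip
    all_goals fin_cases l <;> first | exact absurd rfl hjl | exact absurd rfl hkl | skip
    all_goals
      simp [R, max_eq_left h12, max_eq_left h13, max_eq_left h23, max_eq_right h12,
        max_eq_right h13, max_eq_right h23, min_eq_right h12, min_eq_left h12, min_eq_left h13,
        -Nat.cast_min, -Nat.cast_max, hc]
  intro heq
  rw [← heq] at hR
  obtain ⟨-, -, -, -, -, -, -, h7, -⟩ := hR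
  have hc : (0 : ℝ) < n 2 := by exact_mod_cast h
  simp [R] at h7
  linarith

end Regions

end DYC

theorem theorem2 (n : Fin 3 → ℕ) (h12 : n 1 ≤ n 0) (h23 : n 2 ≤ n 1) :
    (∀ R ∈ DYC.capacityRegion n,
      ∀ (j k l : Fin 3) (hkj : k ≠ j) (hlj : l ≠ j) (hkl : k ≠ l),
        R (DYC.link k j hkj) + R (DYC.link l j hlj) + R (DYC.link k l hkl)
            ≤ ((max (n j) (n l) : ℕ) : ℝ) ∧
        R (DYC.link k j hkj) + R (DYC.link l j hlj) + R (DYC.link k l hkl)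
            ≤ ((max (n k) (n l) : ℕ) : ℝ)) ∧
    DYC.capacityRegion n ⊆ DYC.outerRegion n ∧
    DYC.outerRegion n ⊆ DYC.cutSetRegion n ∧
    (0 < n 2 → DYC.outerRegion n ≠ DYC.cutSetRegion n) :=
  ⟨fun _ hR _ _ _ hkj hlj hkl =>
      ⟨DYC.genie_downlink hR hkj hlj hkl, DYC.genie_uplink hR hkj hlj hkl⟩,
    DYC.capacityRegion_subset_outerRegion h12 h23, DYC.outerRegion_subset_cutSetRegion h12 h23,
    DYC.outerRegion_ne_cutSetRegion h12 h23⟩
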